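/- Let $m\ge 1$ be an integer, let $K\subset\mathbb{R}$ be a real algebraic number field of degree $m+1$ over $\mathbb{Q}$, and let $\alpha_1,\dots,\alpha_m\in K$ be such that $1,\alpha_1,\dots,\alpha_m$ are linearly independent over $\mathbb{Q}$. Put $\mathbf{v}=(1,\alpha_1,\dots,\alpha_m)\in\mathbb{R}^{m+1}$. Then every torus half-line with direction $\mathbf{v}$ is superdense in the unit cube $[0,1)^{m+1}$, with a constant that depends only on $\mathbf{v}$: there is a constant $C=C(\mathbf{v})>0$ such that for every starting point $\mathbf{s}\in\mathbb{R}^{m+1}$, every integer $n\ge 1$ and every point $P\in[0,1)^{m+1}$, the initial segment of length $Cn^{m}$ of the torus half-line $t\mapsto \mathbf{s}+t\mathbf{v} \bmod 1$ $(t\ge 0)$, viewed in $[0,1)^{m+1}$, contains a point at Euclidean distance at most $1/n$ from $P$. -/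

import Mathlib

/-- The half-open unit cube `[0,1)^d` in Euclidean space. -/
def unitCube (d : ℕ) : Set (EuclideanSpace ℝ (Fin d)) :=
  {x | ∀ i, x i ∈ Set.Ico (0 : ℝ) 1}

/-- The position in the cube `[0,1)^d`, at time `t`, of the torus line which starts at `s` and has
direction vector `v`, that is, `s + t v` taken modulo one in every coordinate. -/
noncomputable def torusLine {d : ℕ} (s v : EuclideanSpace ℝ (Fin d)) (t : ℝ) :
    EuclideanSpace ℝ (Fin d) :=
  WithLp.toLp 2 fun i => Int.fract (s i + t * v i)

/-- The initial segment of length `L` of the torus half-line `t ↦ s + t v mod 1`, `0 ≤ t`.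
The motion has Euclidean speed `‖v‖`, so the part traversed up to time `t` has length `t * ‖v‖`. -/
def initialSegment {d : ℕ} (s v : EuclideanSpace ℝ (Fin d)) (L : ℝ) :
    Set (EuclideanSpace ℝ (Fin d)) :=
  {x | ∃ t : ℝ, 0 ≤ t ∧ t * ‖v‖ ≤ L ∧ torusLine s v t = x}

/-- The torus half-line with starting point `s` and direction `v` is superdense in `[0,1)^d`,
with constant `C`: for every integer `n ≥ 1` and every point `P` of the cube, the initial segment
of length `C n^(d-1)` gets `(1/n)`-close to `P` (in the Euclidean distance of the cube itself).
Only meant for `1 ≤ d`. -/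
def SuperdenseWith {d : ℕ} (C : ℝ) (s v : EuclideanSpace ℝ (Fin d)) : Prop :=
  ∀ n : ℕ, 1 ≤ n → ∀ P ∈ unitCube d,
    ∃ x ∈ initialSegment s v (C * (n : ℝ) ^ (d - 1)), dist x P ≤ 1 / (n : ℝ)

/-! If `q v` is close to an integer vector `p`, where the coordinates of `v` form a `ℚ`-basis
`b` of a number field `K`, then multiplication by the elements `D b i` (`D` a common denominator of
the structure constants) turns `p` into integer vectors which are again close to the line `ℝ v`.
They are linearly independent because the form `(x, y) ↦ φ (x y)` is nondegenerate, where `φ` is the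
functional on `K` with values `p` on the basis. So one approximation from Dirichlet's theorem yields
a fundamental domain of a sublattice of `ℤ^(m+1)` within `O(1/N)` of a segment of `ℝ v` of length
`O(N^m)`; hence this segment is an `O(1/N)`-net of the torus, and so are its translates. -/

open Matrix Module

section NumberField

theorem linearIndependent_apply_basis_mul_basis {F K ι : Type*} [Field F] [DivisionRing K]
    [Algebra F K] (b : Basis ι F K) {φ : K →ₗ[F] F} (hφ : φ ≠ 0) :
    LinearIndependent F fun i j => φ (b i * b j) := by
  let Φ : K →ₗ[F] ι → F := LinearMap.pi fun j => φ ∘ₗ LinearMap.mulRight F (b j)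
  refine b.linearIndependent.map' Φ (LinearMap.ker_eq_bot'.2 fun x hx => ?_)
  have hφx : φ ∘ₗ LinearMap.mulLeft F x = 0 := b.ext fun j => congrFun hx j
  by_contra hx0
  refine hφ (LinearMap.ext fun y => ?_)
  simpa [hx0] using LinearMap.congr_fun hφx (x⁻¹ * y)

theorem exists_basis_coe_eq {F L ι : Type*} [Field F] [Field L] [Algebra F L] [Fintype ι]
    [Nonempty ι] {K : IntermediateField F L} (hK : finrank F K = Fintype.card ι) {v : ι → L}
    (hv : ∀ i, v i ∈ K) (hlin : LinearIndependent F v) :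
    ∃ b : Basis ι F K, ∀ i, (b i : L) = v i := by
  have hlin' : LinearIndependent F fun i => (⟨v i, hv i⟩ : K) :=
    LinearIndependent.of_comp K.val.toLinearMap hlin
  exact ⟨basisOfLinearIndependentOfCardEqFinrank hlin' hK.symm, by simp⟩

variable {ι R S : Type*} [Fintype ι] [CommRing R] [CommRing S]

/-- The family `b`, rescaled by the integer `D`, has the integer multiplication table `a`: the
matrix `a i` expresses the products of `D * b i` with the members of `b` in terms of `b`. -/
def IsIntMulTable (b : ι → R) (D : ℤ) (a : ι → Matrix ι ι ℤ) : Prop :=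
  ∀ i, (a i).map Int.cast *ᵥ b = (D * b i) • b

theorem IsIntMulTable.map {b : ι → R} {D : ℤ} {a : ι → Matrix ι ι ℤ} (h : IsIntMulTable b D a)
    (σ : R →+* S) : IsIntMulTable (σ ∘ b) D a := fun i => by
  ext j
  simpa [mulVec, dotProduct] using congrArg σ (congrFun (h i) j)

variable {K : Type*} [Field K] [Algebra ℚ K]

theorem exists_isIntMulTable (b : Basis ι ℚ K) :
    ∃ D : ℤ, D ≠ 0 ∧ ∃ a, IsIntMulTable b D a := by
  obtain ⟨⟨D, hD⟩, hint⟩ := IsLocalization.exist_integer_multiples_of_finite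
    (nonZeroDivisors ℤ) fun x : ι × ι × ι => b.repr (b x.1 * b x.2.1) x.2.2
  choose a ha using hint
  refine ⟨D, nonZeroDivisors.ne_zero hD, fun i => .of fun j l => a (i, j, l), fun i => ?_⟩
  ext j
  have ha' (l : ι) : (a (i, j, l) : K) = D * algebraMap ℚ K (b.repr (b i * b j) l) := by
    simpa [-eq_ratCast] using congrArg (algebraMap ℚ K) (ha (i, j, l))
  calc ∑ l, (a (i, j, l) : K) * b l
      = D * ∑ l, b.repr (b i * b j) l • b l := by
        simp only [ha', Finset.mul_sum, Algebra.smul_def, mul_assoc]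
    _ = D * b i * b j := by rw [b.sum_repr, mul_assoc]

theorem IsIntMulTable.linearIndependent_mulVec {b : Basis ι ℚ K} {D : ℤ}
    {a : ι → Matrix ι ι ℤ} (h : IsIntMulTable b D a) (hD : D ≠ 0) {p : ι → ℤ} (hp : p ≠ 0) :
    LinearIndependent ℤ fun i => a i *ᵥ p := by
  let φ : K →ₗ[ℚ] ℚ := b.constr ℚ fun l => (p l : ℚ)
  have hφb (l : ι) : φ (b l) = p l := b.constr_basis ℚ _ l
  have hφ : (D : ℚ) • φ ≠ 0 := by
    refine smul_ne_zero (Int.cast_ne_zero.2 hD) fun hφ0 => hp (funext fun l => ?_)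
    simpa [hφ0] using (hφb l).symm
  refine (linearIndependent_algebraMap_comp_iff (S := ℚ)).1 ?_
  suffices h' : (fun i => algebraMap ℤ ℚ ∘ (a i *ᵥ p)) =
      fun i j => ((D : ℚ) • φ) (b i * b j) by
    rw [h']
    exact linearIndependent_apply_basis_mul_basis b hφ
  ext i j
  have hij : (D : ℚ) • (b i * b j) = ∑ l, (a i j l : ℚ) • b l := by
    simpa [mulVec, dotProduct, Algebra.smul_def, mul_assoc] using (congrFun (h i) j).symm
  rw [LinearMap.smul_apply, ← map_smul, hij]
  simp [mulVec, dotProduct, hφb]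

open scoped Matrix.Norms.Operator in
theorem IsIntMulTable.norm_mulVec_sub_smul_le {v : ι → ℝ} {D : ℤ} {a : ι → Matrix ι ι ℤ}
    (h : IsIntMulTable v D a) (p : ι → ℤ) (q : ℝ) (i : ι) :
    ‖(fun j => ((a i *ᵥ p) j : ℝ)) - (q * (D * v i)) • v‖ ≤
      ‖(a i).map (Int.cast : ℤ → ℝ)‖ * ‖(fun j => (p j : ℝ)) - q • v‖ := by
  have hcast : (fun j => ((a i *ᵥ p) j : ℝ)) = (a i).map Int.cast *ᵥ fun j => (p j : ℝ) := by
    ext j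
    simp [mulVec, dotProduct]
  rw [hcast, mul_smul, ← h i, ← mulVec_smul, ← mulVec_sub]
  exact linfty_opNorm_mulVec _ _

end NumberField

section TorusNet

variable {ι : Type*} [Fintype ι] {v : ι → ℝ} {T ε : ℝ}

/-- The image of the segment `{τ v : |τ| ≤ T}` in the torus `ℝ^ι / ℤ^ι` is an `ε`-net for the
distance induced by the sup norm. -/
def IsTorusNet (v : ι → ℝ) (T ε : ℝ) : Prop :=
  ∀ x : ι → ℝ, ∃ τ, |τ| ≤ T ∧ ∃ u : ι → ℤ, ‖x - (fun k => (u k : ℝ)) - τ • v‖ ≤ ε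

theorem IsTorusNet.mono {T' ε' : ℝ} (h : IsTorusNet v T ε) (hT : T ≤ T') (hε : ε ≤ ε') :
    IsTorusNet v T' ε' := fun x =>
  let ⟨τ, hτ, u, hu⟩ := h x
  ⟨τ, hτ.trans hT, u, hu.trans hε⟩

theorem IsTorusNet.nonneg (h : IsTorusNet v T ε) : 0 ≤ T :=
  let ⟨_, hτ, _⟩ := h 0
  (abs_nonneg _).trans hτ

/-- Rounding down the coordinates of a vector in a basis moves it by a point of the fundamental
parallelepiped; this point is close to a line if the basis vectors are. -/
theorem exists_abs_le_norm_sub_sum_sub_smul_le {E : Type*} [SeminormedAddCommGroup E]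
    [NormedSpace ℝ E] (b : Basis ι ℝ E) (v : E) (t : ι → ℝ) (x : E) :
    ∃ (n : ι → ℤ) (τ : ℝ), |τ| ≤ ∑ i, |t i| ∧
      ‖x - ∑ i, (n i : ℝ) • b i - τ • v‖ ≤ ∑ i, ‖b i - t i • v‖ := by
  let c (i : ι) : ℝ := Int.fract (b.repr x i)
  have hc (i : ι) : |c i| ≤ 1 := by
    rw [abs_of_nonneg (Int.fract_nonneg _)]
    exact (Int.fract_lt_one _).le
  have hx : x - ∑ i, (⌊b.repr x i⌋ : ℝ) • b i - (∑ i, c i * t i) • v =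
      ∑ i, c i • (b i - t i • v) := by
    conv_lhs => enter [1, 1]; rw [← b.sum_repr x]
    simp only [c, ← Int.self_sub_floor, sub_smul, smul_sub, mul_smul, Finset.sum_smul,
      Finset.sum_sub_distrib]
  refine ⟨fun i => ⌊b.repr x i⌋, ∑ i, c i * t i, ?_, ?_⟩
  · refine (Finset.abs_sum_le_sum_abs _ _).trans (Finset.sum_le_sum fun i _ => ?_)
    rw [abs_mul]
    exact mul_le_of_le_one_left (abs_nonneg _) (hc i)
  · rw [hx]
    refine (norm_sum_le _ _).trans (Finset.sum_le_sum fun i _ => ?_)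
    rw [norm_smul, Real.norm_eq_abs]
    exact mul_le_of_le_one_left (norm_nonneg _) (hc i)

theorem isTorusNet_of_linearIndependent {B : ι → ι → ℤ} (hB : LinearIndependent ℤ B)
    (v t : ι → ℝ) :
    IsTorusNet v (∑ i, |t i|) (∑ i, ‖(fun j => (B i j : ℝ)) - t i • v‖) := fun x => by
  have hBℝ : LinearIndependent ℝ fun i j => (B i j : ℝ) :=
    (linearIndependent_algebraMap_comp_iff (R := ℤ) (S := ℝ) (v := B)).2 hB
  obtain ⟨b, hb⟩ : ∃ b : Basis ι ℝ (ι → ℝ), ∀ i, b i = fun j => (B i j : ℝ) := by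
    classical
    exact ⟨basisOfPiSpaceOfLinearIndependent hBℝ,
      congrFun (coe_basisOfPiSpaceOfLinearIndependent hBℝ)⟩
  obtain ⟨n, τ, hτ, hx⟩ := exists_abs_le_norm_sub_sum_sub_smul_le b v t x
  simp only [hb] at hx
  have hu : (fun j => ((∑ i, n i * B i j : ℤ) : ℝ)) = ∑ i, (n i : ℝ) • fun j => (B i j : ℝ) := by
    ext j
    simp
  exact ⟨τ, hτ, fun j => ∑ i, n i * B i j, hu ▸ hx⟩

theorem exists_simultaneous_approximation (α : ι → ℝ) {N : ℕ} (hN : 0 < N) :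
    ∃ q : ℕ, 0 < q ∧ q ≤ N ^ Fintype.card ι ∧
      ∃ p : ι → ℤ, ‖(fun i => (p i : ℝ)) - (q : ℝ) • α‖ ≤ 1 / N := by
  classical
  have hN' : (0 : ℝ) < N := Nat.cast_pos.2 hN
  let box (q : ℕ) (i : ι) : ℤ := ⌊N * Int.fract (q * α i)⌋
  have hbox (q : ℕ) : box q ∈ Fintype.piFinset fun _ : ι => Finset.Ico (0 : ℤ) N := by
    refine Fintype.mem_piFinset.2 fun i => Finset.mem_Ico.2 ⟨Int.floor_nonneg.2 ?_, ?_⟩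
    · exact mul_nonneg hN'.le (Int.fract_nonneg _)
    · exact Int.floor_lt.2 (by simpa using mul_lt_of_lt_one_right hN' (Int.fract_lt_one _))
  obtain ⟨k, hk, l, hl, hkl, hbox_eq⟩ := Finset.exists_ne_map_eq_of_card_lt_of_maps_to
    (s := Finset.range (N ^ Fintype.card ι + 1)) (by simp) fun q _ => hbox q
  wlog hlt : k < l generalizing k l
  · exact this l hl k hk hkl.symm hbox_eq.symm (hkl.lt_or_gt.resolve_left hlt)
  refine ⟨l - k, Nat.sub_pos_of_lt hlt,
    (Nat.sub_le l k).trans (Finset.mem_range_succ_iff.1 hl), fun i => ⌊l * α i⌋ - ⌊k * α i⌋, ?_⟩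
  refine (pi_norm_le_iff_of_nonneg (by positivity)).2 fun i => (le_div_iff₀ hN').2 ?_
  calc ‖((⌊l * α i⌋ - ⌊k * α i⌋ : ℤ) : ℝ) - ((l - k : ℕ) : ℝ) * α i‖ * N
      = |N * Int.fract (k * α i) - N * Int.fract (l * α i)| := by
        rw [← mul_sub, abs_mul, abs_of_pos hN', mul_comm, Real.norm_eq_abs, ← Int.self_sub_floor,
          ← Int.self_sub_floor]
        push_cast [hlt.le]
        ring_nf
    _ ≤ 1 := (Int.abs_sub_lt_one_of_floor_eq_floor (congrFun hbox_eq i)).le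

theorem exists_int_ne_zero_norm_sub_smul_le {m : ℕ} {v : Fin (m + 1) → ℝ} (hv : v 0 = 1) {N : ℕ}
    (hN : 0 < N) :
    ∃ p : Fin (m + 1) → ℤ, p ≠ 0 ∧
      ∃ q : ℕ, q ≤ N ^ m ∧ ‖(fun k => (p k : ℝ)) - (q : ℝ) • v‖ ≤ 1 / N := by
  obtain ⟨q, hq, hqN, p, hp⟩ := exists_simultaneous_approximation (Fin.tail v) hN
  refine ⟨Fin.cons q p, fun h => hq.ne' (Nat.cast_eq_zero.1 (congrFun h 0)), q, by simpa using hqN,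
    (pi_norm_le_iff_of_nonneg (by positivity)).2 (Fin.cases ?_ fun k => ?_)⟩
  · simp [hv]
  · exact (norm_le_pi_norm _ k).trans hp

section NumberField

variable {K : Type*} [Field K] [Algebra ℚ K] (σ : K →+* ℝ)

open scoped Matrix.Norms.Operator in
theorem exists_forall_int_ne_zero_isTorusNet (b : Basis ι ℚ K) :
    ∃ A : ℝ, 0 ≤ A ∧ ∀ p : ι → ℤ, p ≠ 0 → ∀ q : ℝ,
      IsTorusNet (σ ∘ b) (A * |q|) (A * ‖(fun k => (p k : ℝ)) - q • (σ ∘ b)‖) := by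
  obtain ⟨D, hD, a, ha⟩ := exists_isIntMulTable b
  let G : ℝ := ∑ i, |D * (σ ∘ b) i|
  let H : ℝ := ∑ i, ‖(a i).map (Int.cast : ℤ → ℝ)‖
  have hG : 0 ≤ G := Finset.sum_nonneg fun _ _ => abs_nonneg _
  refine ⟨max G H, le_max_of_le_left hG, fun p hp q => ?_⟩
  refine (isTorusNet_of_linearIndependent (ha.linearIndependent_mulVec hD hp) (σ ∘ b)
    fun i => q * (D * (σ ∘ b) i)).mono ?_ ?_
  · calc ∑ i, |q * (D * (σ ∘ b) i)| = G * |q| := by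
          simp only [G, abs_mul q, ← Finset.mul_sum, mul_comm]
      _ ≤ max G H * |q| := by
          gcongr
          exact le_max_left G H
  · refine (Finset.sum_le_sum fun i _ => (ha.map σ).norm_mulVec_sub_smul_le p q i).trans ?_
    rw [← Finset.sum_mul]
    gcongr
    exact le_max_right G H

theorem exists_forall_isTorusNet {m : ℕ} (b : Basis (Fin (m + 1)) ℚ K) (hb : b 0 = 1) :
    ∃ A : ℝ, ∀ N : ℕ, 0 < N → IsTorusNet (σ ∘ b) (A * N ^ m) (A / N) := by
  obtain ⟨A, hA, hnet⟩ := exists_forall_int_ne_zero_isTorusNet σ b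
  refine ⟨A, fun N hN => ?_⟩
  obtain ⟨p, hp0, q, hq, hp⟩ := exists_int_ne_zero_norm_sub_smul_le
    (v := σ ∘ b) (by simp [hb]) hN
  refine (hnet p hp0 q).mono ?_ ?_
  · rw [Nat.abs_cast]
    gcongr
    exact_mod_cast hq
  · rw [← mul_one_div]
    gcongr

end NumberField

end TorusNet

section Superdense

theorem exists_mem_Icc_abs_sub_le {δ P : ℝ} (hδ0 : 0 ≤ δ) (hδ : δ ≤ 1 / 2)
    (hP : P ∈ Set.Icc (0 : ℝ) 1) : ∃ y ∈ Set.Icc δ (1 - δ), |y - P| ≤ δ := by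
  refine ⟨max δ (min P (1 - δ)), ⟨le_max_left _ _, max_le (by linarith) (min_le_right _ _)⟩,
    abs_sub_le_iff.2 ⟨?_, ?_⟩⟩
  · rw [sub_le_iff_le_add']
    exact max_le (by linarith [hP.1]) ((min_le_left _ _).trans (by linarith))
  · rw [sub_le_comm]
    exact le_max_of_le_right (le_min (by linarith) (by linarith [hP.2]))

theorem abs_fract_sub_lt {x y δ : ℝ} {n : ℤ} (hy : y ∈ Set.Icc δ (1 - δ))
    (hx : |x - n - y| < δ) : |Int.fract x - y| < δ := by
  obtain ⟨hlo, hhi⟩ := abs_lt.1 hx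
  have hfract : Int.fract x = x - n :=
    Int.fract_eq_iff.2 ⟨by linarith [hy.1], by linarith [hy.2], n, by ring⟩
  rwa [hfract]

variable {d : ℕ} {v : EuclideanSpace ℝ (Fin d)}

/-- Shifting the segment `|τ| ≤ T` by `T` gives a segment of the half-line. The target `P` is
first moved away from the faces of the cube: distances are taken in the cube, not in the torus. -/
theorem IsTorusNet.exists_torusLine_near {T ε δ : ℝ} (h : IsTorusNet v.ofLp T ε) (hεδ : ε < δ)
    (hδ : δ ≤ 1 / 2) (s : EuclideanSpace ℝ (Fin d)) {P : EuclideanSpace ℝ (Fin d)}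
    (hP : P ∈ unitCube d) :
    ∃ t ∈ Set.Icc 0 (2 * T), dist (torusLine s v t).ofLp P.ofLp ≤ 2 * δ := by
  have hδ0 : 0 ≤ δ := by
    obtain ⟨_, _, _, hu⟩ := h 0
    exact ((norm_nonneg _).trans hu).trans hεδ.le
  choose y hy hyP using fun k =>
    exists_mem_Icc_abs_sub_le hδ0 hδ (Set.Ico_subset_Icc_self (hP k))
  obtain ⟨τ, hτ, u, hu⟩ := h fun k => y k - s k - T * v k
  obtain ⟨hτlo, hτhi⟩ := abs_le.1 hτ
  refine ⟨T + τ, ⟨by linarith, by linarith⟩, (dist_pi_le_iff (by positivity)).2 fun k => ?_⟩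
  have hline : |torusLine s v (T + τ) k - y k| < δ := by
    refine abs_fract_sub_lt (n := -u k) (hy k) ?_
    calc |s k + (T + τ) * v k - (-u k : ℤ) - y k|
        = |y k - s k - T * v k - u k - τ * v k| := by
          rw [← abs_neg]
          push_cast
          ring_nf
      _ ≤ ε := (norm_le_pi_norm _ k).trans hu
      _ < δ := hεδ
  calc |torusLine s v (T + τ) k - P k|
      ≤ |torusLine s v (T + τ) k - y k| + |y k - P k| := abs_sub_le _ _ _
    _ ≤ 2 * δ := by linarith [hyP k]

theorem exists_superdenseWith_of_isTorusNet {A : ℝ}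
    (h : ∀ N : ℕ, 0 < N → IsTorusNet v.ofLp (A * N ^ (d - 1)) (A / N)) :
    ∃ C : ℝ, 0 < C ∧ ∀ s, SuperdenseWith C s v := by
  obtain ⟨c, hc0, hc⟩ : ∃ c : ℝ, 0 ≤ c ∧ ∀ x y : EuclideanSpace ℝ (Fin d),
      dist x y ≤ c * dist x.ofLp y.ofLp :=
    ⟨_, NNReal.coe_nonneg _, (PiLp.antilipschitzWith_ofLp 2 _).le_mul_dist⟩
  obtain ⟨r, hr⟩ := exists_nat_gt (max 0 (2 * (c + 1) * A))
  have hr0 : (0 : ℝ) < r := (le_max_left _ _).trans_lt hr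
  have hrA : 2 * (c + 1) * A < r := (le_max_right _ _).trans_lt hr
  have hAr : 0 ≤ A * r ^ (d - 1) := (h r (Nat.cast_pos.1 hr0)).nonneg
  refine ⟨2 * (A * r ^ (d - 1)) * ‖v‖ + 1, by positivity, fun s n hn P hP => ?_⟩
  have hn1 : (1 : ℝ) ≤ n := Nat.one_le_cast.2 hn
  have hrn : 0 < r * n := Nat.mul_pos (Nat.cast_pos.1 hr0) hn
  set δ : ℝ := 1 / (2 * (c + 1) * n) with hδ
  have hδA : A / (r * n : ℕ) < δ := by
    rw [hδ, div_lt_div_iff₀ (Nat.cast_pos.2 hrn) (by positivity)]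
    push_cast
    nlinarith
  have hδ2 : δ ≤ 1 / 2 := by
    rw [hδ]
    gcongr
    nlinarith
  obtain ⟨t, ⟨ht0, htT⟩, ht⟩ := (h (r * n) hrn).exists_torusLine_near hδA hδ2 s hP
  refine ⟨torusLine s v t, ⟨t, ht0, ?_, rfl⟩, ?_⟩
  · calc t * ‖v‖ ≤ 2 * (A * (r * n : ℕ) ^ (d - 1)) * ‖v‖ := by gcongr
      _ = 2 * (A * r ^ (d - 1)) * ‖v‖ * n ^ (d - 1) := by
        push_cast
        ring
      _ ≤ (2 * (A * r ^ (d - 1)) * ‖v‖ + 1) * n ^ (d - 1) := by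
        gcongr
        exact le_add_of_nonneg_right zero_le_one
  · calc dist (torusLine s v t) P ≤ c * (2 * δ) := (hc _ _).trans (by gcongr)
      _ ≤ (c + 1) * (2 * δ) := by
        gcongr
        exact le_add_of_nonneg_right zero_le_one
      _ = 1 / n := by
        rw [hδ]
        field_simp

end Superdense

theorem lemma6p1p2 (m : ℕ) (hm : 1 ≤ m) (K : IntermediateField ℚ ℝ)
    (hK : Module.finrank ℚ K = m + 1) (α : Fin m → ℝ) (hα : ∀ i, α i ∈ K)
    (hlin : LinearIndependent ℚ (Fin.cons 1 α : Fin (m + 1) → ℝ)) :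
    ∃ C : ℝ, 0 < C ∧ ∀ s : EuclideanSpace ℝ (Fin (m + 1)),
      SuperdenseWith C s (WithLp.toLp 2 (Fin.cons 1 α : Fin (m + 1) → ℝ)) := by
  have hv (i : Fin (m + 1)) : (Fin.cons 1 α : Fin (m + 1) → ℝ) i ∈ K :=
    Fin.cases K.one_mem hα i
  obtain ⟨b, hb⟩ := exists_basis_coe_eq (by simpa using hK) hv hlin
  have hbv : K.val.toRingHom ∘ b = Fin.cons 1 α := funext hb
  obtain ⟨A, hA⟩ := exists_forall_isTorusNet K.val.toRingHom b (Subtype.ext (hb 0))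
  rw [hbv] at hA
  exact exists_superdenseWith_of_isTorusNet hA
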